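/- Let $G$ be a finite group, let $\chi$ be an irreducible complex character of $G$, and suppose that $\chi$ is quasi-primitive, i.e. for every normal subgroup $N$ of $G$ the restriction $\chi|_N$ is a multiple of an irreducible character of $N$. Suppose that $G$ is $p$-solvable for every prime $p$ dividing $\chi(1)$, where a finite group is called $p$-solvable if it has a series of normal subgroups, from the trivial subgroup to the whole group, each of whose factors has order either a power of $p$ or prime to $p$. Then for every $x\in G$, $|\chi(x)|^2$ is either zero or a positive integer dividing $\chi(1)^2$. -/

import Mathlib

/-- `χ ∈ Irr(G)`: `χ` is the character (trace function) of an irreducible complex representation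
of `G` of finite degree, given here on the space `ℂⁿ`. -/
def IsIrrChar {G : Type*} [Group G] (χ : G → ℂ) : Prop :=
  ∃ (n : ℕ) (ρ : Representation ℂ G (Fin n → ℂ)), ρ.IsIrreducible ∧ ∀ g, χ g = ρ.character g

/-- A quasi-primitive character: an irreducible character whose restriction to any normal subgroup
`N` is a multiple of an irreducible character of `N`. -/
def IsQuasiPrimitive {G : Type*} [Group G] (χ : G → ℂ) : Prop :=
  IsIrrChar χ ∧
    ∀ N : Subgroup G, N.Normal →
      ∃ (θ : N → ℂ) (e : ℕ), IsIrrChar θ ∧ ∀ x : N, χ (x : G) = (e : ℂ) * θ x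

/-- The finite group `G` is `p`-solvable: it has a series `1 = H 0 ≤ H 1 ≤ ⋯ ≤ H n = G` of normal
subgroups of `G`, each of whose factors has order a power of `p` or prime to `p`. -/
def IsPSolvable (p : ℕ) (G : Type*) [Group G] : Prop :=
  ∃ (n : ℕ) (H : ℕ → Subgroup G),
    H 0 = ⊥ ∧ H n = ⊤ ∧ (∀ i ≤ n, (H i).Normal) ∧
      ∀ i < n, H i ≤ H (i + 1) ∧
        ((∃ k : ℕ, (H i).relIndex (H (i + 1)) = p ^ k) ∨
          ¬ p ∣ (H i).relIndex (H (i + 1)))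

/-! Let `G` act by conjugation on `A = End(V)`, where `V` affords `χ`. The trace of `x` on `A` is
`χ(x⁻¹)χ(x) = |χ(x)|²`, and `dim A = χ(1)²`. Quasi-primitivity makes the algebra of `N`-fixed points
simple for every normal `N`; irreducibility makes the `G`-fixed points scalar.
`trace_action_eq_zero_or_dvd` works with any such algebra, by induction on its dimension.

Take `M` minimal among normal subgroups acting nontrivially. Let `C` be its fixed algebra, a proper
matrix subalgebra, and `B` the centralizer of `C`. Then `A ≅ B ⊗ C`, so traces and dimensions
multiply, and induction handles `C`. An `M`-fixed element of `B` lies in `B ∩ C = Z(C)`, hence is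
scalar. Let `Q` be the image of `M` in `Aut(B)`.

If `M` acts on `A` through an abelian group, the units of `B` implementing `Q` form a basis of `B`
that `x` permutes up to scalars; its trace on `B` is zero or the order of a subgroup of `Q`, and
`|Q| = dim B` (`trace_eq_zero_or_dvd_of_commutative`). Otherwise `p`-solvability makes the order of
the image of `M` in `Aut(A)` prime to every `p` dividing `dim A`. But `B ≅ Mat_f(ℂ)` is an
irreducible projective representation of `Q` of degree `f`, so `f` divides `|Q|`
(`dvd_card_of_projective`), forcing `f = 1` and `C = A`, a contradiction. -/

/-! ### Matrix subalgebras, their centralizers, and inner automorphisms -/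

/-- Given a copy of a matrix algebra inside `A` with centralizer `B`, the algebra `A` is the matrix
algebra over `B`. -/
noncomputable def matrixCentralizerHom {K A : Type*} [Field K] [Ring A] [Algebra K A] {k : ℕ}
    (ψ : Matrix (Fin k) (Fin k) K →ₐ[K] A) :
    TensorProduct K (Subalgebra.centralizer K (ψ.range : Set A)) (Matrix (Fin k) (Fin k) K)
      →ₐ[K] A :=
  Algebra.TensorProduct.lift (Subalgebra.centralizer K (ψ.range : Set A)).val ψ
    (fun b c => ((Subalgebra.mem_centralizer_iff K).1 b.2 (ψ c) ⟨c, rfl⟩).symm)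

theorem matrixCentralizerHom_tmul {K A : Type*} [Field K] [Ring A] [Algebra K A] {k : ℕ}
    (ψ : Matrix (Fin k) (Fin k) K →ₐ[K] A)
    (b : Subalgebra.centralizer K (ψ.range : Set A)) (c : Matrix (Fin k) (Fin k) K) :
    matrixCentralizerHom ψ (b ⊗ₜ c) = b * ψ c :=
  Algebra.TensorProduct.lift_tmul ..

theorem matrixCentralizerHom_matrix {K A : Type*} [Field K] [Ring A] [Algebra K A] {k : ℕ}
    (ψ : Matrix (Fin k) (Fin k) K →ₐ[K] A)
    (X : Matrix (Fin k) (Fin k) (Subalgebra.centralizer K (ψ.range : Set A))) :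
    matrixCentralizerHom ψ (matrixEquivTensor (Fin k) K _ X) =
      ∑ i, ∑ j, (X i j : A) * ψ (Matrix.single i j 1) := by
  rw [matrixEquivTensor_apply, map_sum, Fintype.sum_prod_type]
  simp [matrixCentralizerHom_tmul]

theorem matrixCentralizerHom_bijective {K A : Type*} [Field K] [Ring A] [Algebra K A] {k : ℕ}
    (ψ : Matrix (Fin k) (Fin k) K →ₐ[K] A) : Function.Bijective (matrixCentralizerHom ψ) := by
  classical
  have comm : ∀ (b : Subalgebra.centralizer K (ψ.range : Set A)) c, ψ c * b = b * ψ c :=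
    fun b c => (Subalgebra.mem_centralizer_iff K).1 b.2 (ψ c) ⟨c, rfl⟩
  constructor
  · rw [injective_iff_map_eq_zero]
    intro t ht
    obtain ⟨X, rfl⟩ := (matrixEquivTensor (Fin k) K _).surjective t
    rw [matrixCentralizerHom_matrix] at ht
    suffices X = 0 by rw [this, map_zero]
    ext p q
    -- Sandwiching between matrix units and summing over `l` isolates the coefficient `X p q`.
    have h1 : ∑ l, ψ (Matrix.single l p 1) *
        (∑ i, ∑ j, (X i j : A) * ψ (Matrix.single i j 1)) * ψ (Matrix.single q l 1) = 0 := by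
      simp [ht]
    have h2 : ∀ l, ψ (Matrix.single l p 1) *
        (∑ i, ∑ j, (X i j : A) * ψ (Matrix.single i j 1)) * ψ (Matrix.single q l 1)
        = (X p q : A) * ψ (Matrix.single l l 1) := by
      intro l
      simp only [Finset.mul_sum, Finset.sum_mul]
      have : ∀ i j, ψ (Matrix.single l p 1) * ((X i j : A) * ψ (Matrix.single i j 1)) *
          ψ (Matrix.single q l 1) =
          if p = i then (if j = q then (X i j : A) * ψ (Matrix.single l l 1) else 0) else 0 := by
        intro i j
        rw [← mul_assoc, comm, mul_assoc, mul_assoc, ← map_mul, ← map_mul]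
        by_cases h : p = i
        · subst h
          by_cases h' : j = q
          · subst h'; simp
          · simp [h']
        · have h0 : Matrix.single l p (1 : K) * Matrix.single i j 1 = 0 :=
            Matrix.single_mul_single_of_ne (h := h) ..
          rw [← Matrix.mul_assoc, h0, Matrix.zero_mul, map_zero, mul_zero, if_neg h]
      simp [this]
    simp only [h2] at h1
    rw [← Finset.mul_sum, ← map_sum, Matrix.sum_single_one, map_one, mul_one] at h1
    simpa using h1
  · intro a
    -- These sums are the matrix coefficients of `a`; they commute with every matrix unit.
    have key : ∀ i j, (∑ l, ψ (Matrix.single l i 1) * a * ψ (Matrix.single j l 1)) ∈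
        Subalgebra.centralizer K (ψ.range : Set A) := by
      intro i j
      rw [Subalgebra.mem_centralizer_iff]
      rintro _ ⟨c, rfl⟩
      have hc : ∀ c : Matrix (Fin k) (Fin k) K, c ∈ Submodule.span K
          (Set.range fun p : Fin k × Fin k => Matrix.single p.1 p.2 (1 : K)) := by
        intro c
        rw [Matrix.matrix_eq_sum_single c]
        refine Submodule.sum_mem _ fun p _ => Submodule.sum_mem _ fun q _ => ?_
        rw [show Matrix.single p q (c p q) = c p q • Matrix.single p q (1 : K) by simp]
        exact Submodule.smul_mem _ _ (Submodule.subset_span ⟨(p, q), rfl⟩)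
      refine Submodule.span_induction ?_ (by simp) ?_ ?_ (hc c)
      · rintro _ ⟨⟨p, q⟩, rfl⟩
        simp only [Finset.mul_sum, Finset.sum_mul]
        show ∑ l, ψ (Matrix.single p q 1) * _ = ∑ l, _ * ψ (Matrix.single p q 1)
        rw [Finset.sum_eq_single q, Finset.sum_eq_single p]
        · rw [← mul_assoc, ← mul_assoc, ← map_mul, mul_assoc _ _ (ψ (Matrix.single p q 1)),
            ← map_mul]
          simp
        · intro l _ hl
          rw [mul_assoc, ← map_mul]
          simp [hl]
        · simp
        · intro l _ hl
          rw [← mul_assoc, ← mul_assoc, ← map_mul]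
          simp [hl.symm]
        · simp
      · intro x y _ _ hx hy
        change ψ x * _ = _ * ψ x at hx
        change ψ y * _ = _ * ψ y at hy
        change ψ (x + y) * _ = _ * ψ (x + y)
        rw [map_add, add_mul, mul_add, hx, hy]
      · intro r x _ hx
        change ψ x * _ = _ * ψ x at hx
        change ψ (r • x) * _ = _ * ψ (r • x)
        rw [map_smul, smul_mul_assoc, mul_smul_comm, hx]
    refine ⟨matrixEquivTensor (Fin k) K _ (Matrix.of fun i j => ⟨_, key i j⟩), ?_⟩
    rw [matrixCentralizerHom_matrix]
    have : ∀ i j, (∑ l, ψ (Matrix.single l i 1) * a * ψ (Matrix.single j l 1)) *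
        ψ (Matrix.single i j 1) = ψ (Matrix.single i i 1) * a * ψ (Matrix.single j j 1) := by
      intro i j
      rw [Finset.sum_mul, Finset.sum_eq_single i]
      · rw [mul_assoc, ← map_mul]
        simp
      · intro l _ hl
        rw [mul_assoc, ← map_mul]
        simp [hl]
      · simp
    simp only [Matrix.of_apply, this, ← Finset.mul_sum, ← Finset.sum_mul]
    rw [← map_sum, Matrix.sum_single_one, map_one]
    simp

/-- `matrixCentralizerHom` as an isomorphism. -/
noncomputable def matrixCentralizerEquiv {K A : Type*} [Field K] [Ring A] [Algebra K A] {k : ℕ}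
    (ψ : Matrix (Fin k) (Fin k) K →ₐ[K] A) :
    TensorProduct K (Subalgebra.centralizer K (ψ.range : Set A)) (Matrix (Fin k) (Fin k) K)
      ≃ₐ[K] A :=
  AlgEquiv.ofBijective _ (matrixCentralizerHom_bijective ψ)

/-- `A` is a matrix ring over the centralizer, and two-sided ideals of a ring correspond to those of
its matrix rings. -/
theorem isSimpleRing_centralizer_matrix {K A : Type*} [Field K] [Ring A] [Algebra K A]
    [IsSimpleRing A] {k : ℕ} (ψ : Matrix (Fin k) (Fin k) K →ₐ[K] A) :
    IsSimpleRing (Subalgebra.centralizer K (ψ.range : Set A)) := by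
  classical
  have hk : Nonempty (Fin k) := by
    by_contra h
    have : Subsingleton (Matrix (Fin k) (Fin k) K) := by
      rw [not_nonempty_iff] at h
      infer_instance
    have h10 : (1 : A) = 0 := by
      rw [← map_one ψ, Subsingleton.elim (1 : Matrix (Fin k) (Fin k) K) 0, map_zero]
    exact one_ne_zero h10
  have := IsSimpleRing.of_ringEquiv
    ((matrixEquivTensor (Fin k) K _).trans (matrixCentralizerEquiv ψ)).symm.toRingEquiv ‹_›
  exact ⟨(TwoSidedIdeal.orderIsoMatrix (n := Fin k)).isSimpleOrder⟩

theorem exists_matrixHom_range_eq {K A : Type*} [Field K] [Ring A] [Algebra K A]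
    {k : ℕ} (C : Subalgebra K A) (e : C ≃ₐ[K] Matrix (Fin k) (Fin k) K) :
    ∃ ψ : Matrix (Fin k) (Fin k) K →ₐ[K] A, ψ.range = C ∧ ∀ c : C, ψ (e c) = c := by
  refine ⟨C.val.comp e.symm.toAlgHom, ?_, fun c => by simp⟩
  ext a
  constructor
  · rintro ⟨x, rfl⟩
    exact (e.symm x).2
  · intro ha
    exact ⟨e ⟨a, ha⟩, by simp⟩

/-- If `C` is a matrix algebra inside `A`, then the trace of a linear map of `A` compatible with
maps of `C` and of its centralizer `B` is the product of their traces. -/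
theorem trace_eq_mul_of_centralizer {K A : Type*} [Field K] [Ring A] [Algebra K A]
    {k : ℕ} (C : Subalgebra K A) (e : C ≃ₐ[K] Matrix (Fin k) (Fin k) K)
    [FiniteDimensional K A]
    (T : A →ₗ[K] A) (TC : C →ₗ[K] C)
    (TB : Subalgebra.centralizer K (C : Set A) →ₗ[K] Subalgebra.centralizer K (C : Set A))
    (h : ∀ (b : Subalgebra.centralizer K (C : Set A)) (c : C),
      T ((b : A) * (c : A)) = (TB b : A) * (TC c : A)) :
    LinearMap.trace K A T = LinearMap.trace K _ TB * LinearMap.trace K _ TC := by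
  obtain ⟨ψ, rfl, hψ⟩ := exists_matrixHom_range_eq C e
  let E := (TensorProduct.congr (LinearEquiv.refl K _) e.toLinearEquiv).trans
      (matrixCentralizerEquiv ψ).toLinearEquiv
  have hE : ∀ b c, E (b ⊗ₜ c) = b * c := by
    intro b c
    change matrixCentralizerHom ψ (b ⊗ₜ e c) = _
    rw [matrixCentralizerHom_tmul, hψ]
  rw [← LinearMap.trace_tensorProduct', ← LinearMap.trace_conj' _ E]
  congr 1
  ext a
  obtain ⟨t, rfl⟩ := E.surjective a
  induction t using TensorProduct.induction_on with
  | zero => simp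
  | add x y hx hy => rw [map_add, map_add, map_add, hx, hy]
  | tmul b c =>
    rw [LinearEquiv.conj_apply_apply, E.symm_apply_apply, TensorProduct.map_tmul, hE, hE, h]

theorem finrank_eq_mul_of_centralizer {K A : Type*} [Field K] [Ring A] [Algebra K A]
    {k : ℕ} (C : Subalgebra K A) (e : C ≃ₐ[K] Matrix (Fin k) (Fin k) K)
    [FiniteDimensional K A] :
    Module.finrank K A = Module.finrank K (Subalgebra.centralizer K (C : Set A)) *
      Module.finrank K C := by
  obtain ⟨ψ, rfl, -⟩ := exists_matrixHom_range_eq C e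
  rw [e.toLinearEquiv.finrank_eq, ← Module.finrank_tensorProduct,
    (matrixCentralizerEquiv ψ).toLinearEquiv.finrank_eq]

/-- **Skolem–Noether** for matrix algebras: every automorphism is inner. -/
theorem AlgEquiv.exists_unit_conj {K B : Type*} [Field K] [Ring B] [Algebra K B] {f : ℕ}
    (e : B ≃ₐ[K] Matrix (Fin f) (Fin f) K) (α : B ≃ₐ[K] B) :
    ∃ u : Bˣ, ∀ b, α b = u * b * ↑u⁻¹ := by
  let e' : B ≃ₐ[K] Module.End K (Fin f → K) := e.trans Matrix.toLinAlgEquiv'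
  obtain ⟨T, hT⟩ := AlgEquiv.eq_linearEquivConjAlgEquiv (e'.symm.trans (α.trans e'))
  let v : (Module.End K (Fin f → K))ˣ := LinearMap.GeneralLinearGroup.ofLinearEquiv T
  refine ⟨Units.map (e'.symm : Module.End K (Fin f → K) →* B) v, fun b => e'.injective ?_⟩
  have := congrArg (fun g => g (e' b)) hT
  simp only [AlgEquiv.trans_apply, AlgEquiv.symm_apply_apply] at this
  rw [this, map_mul, map_mul]
  ext x
  simp [LinearEquiv.conjAlgEquiv_apply, v, ← map_inv]
  rfl

/-! ### Automorphism groups of a matrix algebra with only scalar fixed points -/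

section
variable {B : Type*} [Ring B] [Algebra ℂ B] {u : (B ≃ₐ[ℂ] B) → Bˣ}

/-- The quotient `w⁻¹v` is central, so it is fixed by every inner automorphism, in particular by
`Q`. -/
theorem exists_smul_of_conj_eq {Q : Subgroup (B ≃ₐ[ℂ] B)} [Nontrivial B]
    (hu : ∀ α b, α b = u α * b * ↑(u α)⁻¹)
    (hfix : ∀ b, (∀ q ∈ Q, q b = b) → ∃ c : ℂ, b = algebraMap ℂ B c)
    (v w : Bˣ) (h : ∀ b : B, v * b * ↑v⁻¹ = w * b * ↑w⁻¹) :
    ∃ c : ℂ, c ≠ 0 ∧ (v : B) = c • (w : B) := by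
  have h1 : ∀ b : B, b * (↑w⁻¹ * v : B) = ↑w⁻¹ * v * b := by
    intro b
    have := h b
    rw [Units.mul_inv_eq_iff_eq_mul] at this
    rw [mul_assoc (↑w⁻¹ : B), this]
    simp [mul_assoc]
  obtain ⟨c, hc⟩ := hfix (↑w⁻¹ * v) (fun q _ => by
    rw [hu, h1, mul_assoc, Units.mul_inv, mul_one])
  have hv : (v : B) = c • (w : B) := by
    rw [Units.inv_mul_eq_iff_eq_mul] at hc
    rw [hc, ← Algebra.commutes, Algebra.smul_def]
  refine ⟨c, ?_, hv⟩
  rintro rfl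
  rw [zero_smul] at hv
  exact v.ne_zero hv

theorem exists_smul_conj {Q : Subgroup (B ≃ₐ[ℂ] B)} [Nontrivial B]
    (hu : ∀ α b, α b = u α * b * ↑(u α)⁻¹)
    (hfix : ∀ b, (∀ q ∈ Q, q b = b) → ∃ c : ℂ, b = algebraMap ℂ B c)
    (α β : B ≃ₐ[ℂ] B) : ∃ c : ℂ, c ≠ 0 ∧ α (u β) = c • (u (α * β * α⁻¹) : B) := by
  refine exists_smul_of_conj_eq hu hfix (Units.map (α : B →* B) (u β)) (u (α * β * α⁻¹)) ?_
  intro b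
  rw [← hu]
  obtain ⟨b, rfl⟩ := α.surjective b
  rw [← map_inv]
  simp only [Units.coe_map, MonoidHom.coe_coe, ← map_mul, ← hu]
  rw [AlgEquiv.mul_apply, AlgEquiv.mul_apply]
  congr 2
  exact (α.symm_apply_apply b).symm

theorem exists_smul_mul {Q : Subgroup (B ≃ₐ[ℂ] B)} [Nontrivial B]
    (hu : ∀ α b, α b = u α * b * ↑(u α)⁻¹)
    (hfix : ∀ b, (∀ q ∈ Q, q b = b) → ∃ c : ℂ, b = algebraMap ℂ B c)
    (α β : B ≃ₐ[ℂ] B) : ∃ c : ℂ, c ≠ 0 ∧ (u (α * β) : B) = c • (u α * u β : B) := by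
  refine exists_smul_of_conj_eq hu hfix (u (α * β)) (u α * u β) fun b => ?_
  rw [← hu, AlgEquiv.mul_apply, hu α, hu β]
  simp [mul_assoc]

theorem eq_one_of_forall_fixed {Q : Subgroup (B ≃ₐ[ℂ] B)}
    (hu : ∀ α b, α b = u α * b * ↑(u α)⁻¹)
    (hfix : ∀ b, (∀ q ∈ Q, q b = b) → ∃ c : ℂ, b = algebraMap ℂ B c)
    (α : B ≃ₐ[ℂ] B) (h : ∀ q ∈ Q, q (u α) = u α) : α = 1 := by
  obtain ⟨c, hc⟩ := hfix _ h
  ext b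
  rw [hu, hc, Algebra.commutes, ← hc, mul_assoc, Units.mul_inv, mul_one]
  rfl

/-- Let `Q` be a commutative group of automorphisms of a matrix algebra `B` whose only common fixed
points are scalars. Then an automorphism normalizing `Q` has trace zero or a divisor of `dim B`. -/
theorem trace_eq_zero_or_dvd_of_commutative [Nontrivial B] [FiniteDimensional ℂ B]
    (Q : Subgroup (B ≃ₐ[ℂ] B)) [Finite Q] (hcomm : ∀ q ∈ Q, ∀ r ∈ Q, q * r = r * q)
    (hu : ∀ α b, α b = u α * b * ↑(u α)⁻¹)
    (hfix : ∀ b, (∀ q ∈ Q, q b = b) → ∃ c : ℂ, b = algebraMap ℂ B c)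
    (X : B ≃ₐ[ℂ] B) (hX : ∀ q ∈ Q, X * q * X⁻¹ ∈ Q) :
    LinearMap.trace ℂ B X.toLinearMap = 0 ∨ ∃ m : ℕ, 0 < m ∧ m ∣ Module.finrank ℂ B ∧
      LinearMap.trace ℂ B X.toLinearMap = m := by
  classical
  have := Fintype.ofFinite Q
  -- `μ` records how automorphisms permute the units `u β` up to scalars. On the commutative group
  -- `Q` it is a bicharacter, nondegenerate on both sides because the fixed points of `Q` are
  -- scalar.
  choose μ hμ0 hμ using exists_smul_conj hu hfix
  have cancel : ∀ (a b : ℂ) (v : Bˣ), a • (v : B) = b • (v : B) → a = b :=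
    fun a b v h => smul_left_injective ℂ v.ne_zero h
  have hμ' : ∀ α q, α * q * α⁻¹ = q → α (u q) = μ α q • (u q : B) := by
    intro α q h
    rw [hμ, h]
  have mulr : ∀ α q r, α * q * α⁻¹ = q → α * r * α⁻¹ = r →
      μ α (q * r) = μ α q * μ α r := by
    intro α q r hq hr
    have hqr : α * (q * r) * α⁻¹ = q * r := by
      conv_rhs => rw [← hq, ← hr]
      group
    obtain ⟨d, -, hd⟩ := exists_smul_mul hu hfix q r
    apply cancel _ _ (u (q * r))
    rw [← hμ' α _ hqr]
    rw [hd, map_smul, map_mul, hμ' α _ hq, hμ' α _ hr, smul_mul_smul_comm, smul_comm]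
  have mull : ∀ α β q, α * q * α⁻¹ = q → β * q * β⁻¹ = q →
      μ (α * β) q = μ α q * μ β q := by
    intro α β q hα hβ
    have hqr : (α * β) * q * (α * β)⁻¹ = q := by
      conv_rhs => rw [← hα, ← hβ]
      group
    apply cancel _ _ (u q)
    rw [← hμ' _ _ hqr, AlgEquiv.mul_apply, hμ' _ _ hβ, map_smul, hμ' _ _ hα, smul_smul, mul_comm]
  have hQ : ∀ q r : Q, (q : B ≃ₐ[ℂ] B) * r * (q : B ≃ₐ[ℂ] B)⁻¹ = r := by
    intro q r
    rw [hcomm q q.2 r r.2, mul_inv_cancel_right]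
  let rhom : Q → Q →* ℂ := fun q => (Units.coeHom ℂ).comp
    (MonoidHom.mk' (fun r : Q => Units.mk0 (μ q r) (hμ0 _ _)) (fun r s => by
      ext; exact mulr _ _ _ (hQ q r) (hQ q s)))
  let lhom : Q → Q →* ℂ := fun r => (Units.coeHom ℂ).comp
    (MonoidHom.mk' (fun q : Q => Units.mk0 (μ q r) (hμ0 _ _)) (fun q s => by
      ext; exact mull _ _ _ (hQ q r) (hQ s r)))
  have rhom_apply : ∀ q r, rhom q r = μ q r := fun _ _ => rfl
  have lhom_apply : ∀ q r, lhom r q = μ q r := fun _ _ => rfl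
  have lhom_one : ∀ r, lhom r = 1 → r = 1 := by
    intro r hr
    ext1
    refine eq_one_of_forall_fixed hu hfix _ fun q hq => ?_
    rw [hμ' _ _ (hQ ⟨q, hq⟩ r), ← lhom_apply ⟨q, hq⟩ r, hr, MonoidHom.one_apply, one_smul]
  have rhom_one : ∀ r, rhom r = 1 → r = 1 := by
    intro r hr
    ext1
    refine eq_one_of_forall_fixed hu hfix _ fun q hq => ?_
    have h := hμ' _ _ (hQ r ⟨q, hq⟩)
    rw [← rhom_apply r ⟨q, hq⟩, hr, MonoidHom.one_apply, one_smul, hu,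
      Units.mul_inv_eq_iff_eq_mul] at h
    rw [hu, ← h, mul_assoc, Units.mul_inv, mul_one]
  have hcard : (Fintype.card Q : ℂ) ≠ 0 := Nat.cast_ne_zero.2 Fintype.card_ne_zero
  have hli : LinearIndependent ℂ (fun q : Q => (u q : B)) := by
    rw [Fintype.linearIndependent_iff]
    intro c hc s
    -- Projection onto the `μ · s`-eigenspace: orthogonality of characters kills every term except
    -- `q = s`.
    have h1 : ∑ r : Q, μ r (s⁻¹ : Q) • (r : B ≃ₐ[ℂ] B) (∑ q : Q, c q • (u q : B)) = 0 := by
      simp [hc]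
    have h2 : ∑ r : Q, μ r (s⁻¹ : Q) • (r : B ≃ₐ[ℂ] B) (∑ q : Q, c q • (u q : B)) =
        ∑ q : Q, (c q * ∑ r : Q, lhom (s⁻¹ * q) r) • (u q : B) := by
      simp only [map_sum, Finset.smul_sum, Finset.mul_sum, Finset.sum_smul]
      rw [Finset.sum_comm]
      refine Finset.sum_congr rfl fun q _ => Finset.sum_congr rfl fun r _ => ?_
      rw [map_smul, hμ' _ _ (hQ r q), smul_smul, smul_smul]
      congr 1
      have : lhom (s⁻¹ * q) r = μ r (s⁻¹ : Q) * μ r q := (rhom r).map_mul s⁻¹ q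
      rw [this]
      ring
    rw [h2, Finset.sum_eq_single s] at h1
    · rw [inv_mul_cancel] at h1
      have : lhom 1 = 1 := by
        ext r
        exact (rhom r).map_one
      rw [sum_hom_units, if_pos this] at h1
      have := cancel _ 0 (u s) (by rw [h1, zero_smul])
      exact (mul_eq_zero.1 this).resolve_right (by exact_mod_cast hcard)
    · intro q _ hq
      rw [sum_hom_units, if_neg, Nat.cast_zero, mul_zero, zero_smul]
      intro h
      exact hq (inv_mul_eq_one.1 (lhom_one _ h)).symm
    · simp
  have hsp : ⊤ ≤ Submodule.span ℂ (Set.range fun q : Q => (u q : B)) := by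
    intro b _
    -- `y q` is, up to the factor `|Q|`, the component of `b` on which `Q` acts through `μ · q`.
    -- Since `u q` has the same eigencharacter, `(u q)⁻¹ * y q` is fixed by `Q`, hence scalar.
    let y : Q → B := fun q => ∑ r : Q, μ (r⁻¹ : Q) q • (r : B ≃ₐ[ℂ] B) b
    have hy : ∀ s q : Q, (s : B ≃ₐ[ℂ] B) (y q) = μ s q • y q := by
      intro s q
      simp only [y, map_sum, map_smul, Finset.smul_sum]
      rw [← Equiv.sum_comp (Equiv.mulLeft s) fun r : Q =>
        μ s q • μ (r⁻¹ : Q) q • (r : B ≃ₐ[ℂ] B) b]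
      refine Finset.sum_congr rfl fun r _ => ?_
      rw [smul_smul, Equiv.coe_mulLeft, ← lhom_apply s q, ← lhom_apply (s * r)⁻¹ q, ← map_mul,
        show s * (s * r)⁻¹ = r⁻¹ by
          ext1
          push_cast
          rw [mul_inv_rev, hcomm _ (inv_mem r.2) _ (inv_mem s.2), mul_inv_cancel_left]]
      rfl
    have hy' : ∀ q, y q ∈ Submodule.span ℂ (Set.range fun q : Q => (u q : B)) := by
      intro q
      obtain ⟨c, hc⟩ := hfix (↑(u q)⁻¹ * y q) (fun s hs => by
        have h1 : s (↑(u q)⁻¹ : B) = (μ s q)⁻¹ • (↑(u q)⁻¹ : B) := by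
          have h2 := hμ' _ _ (hQ ⟨s, hs⟩ q)
          have h3 : s (↑(u q)⁻¹ : B) * s (u q) = 1 := by
            rw [← map_mul, Units.inv_mul, map_one]
          rw [h2, mul_smul_comm] at h3
          rw [← smul_mul_assoc] at h3
          rw [eq_inv_smul_iff₀ (hμ0 _ _), (Units.eq_mul_inv_iff_mul_eq (u q)).2 h3, one_mul]
        rw [map_mul, h1, hy ⟨s, hs⟩ q, smul_mul_smul_comm, inv_mul_cancel₀ (hμ0 _ _), one_smul])
      rw [Units.inv_mul_eq_iff_eq_mul, ← Algebra.commutes, ← Algebra.smul_def] at hc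
      rw [hc]
      exact Submodule.smul_mem _ _ (Submodule.subset_span ⟨q, rfl⟩)
    have h3 : ∑ q : Q, y q = (Fintype.card Q : ℂ) • b := by
      simp only [y]
      rw [Finset.sum_comm]
      simp only [← Finset.sum_smul, ← rhom_apply, sum_hom_units]
      rw [Finset.sum_eq_single 1]
      · rw [if_pos]
        · rfl
        · ext q
          rw [inv_one]
          exact (lhom q).map_one
      · intro r _ hr
        rw [if_neg, Nat.cast_zero, zero_smul]
        intro h
        exact hr (inv_eq_one.1 (rhom_one _ h))
      · simp
    have h4 : b = (Fintype.card Q : ℂ)⁻¹ • ∑ q : Q, y q := by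
      rw [h3, inv_smul_smul₀ hcard]
    rw [h4]
    exact Submodule.smul_mem _ _ (Submodule.sum_mem _ fun q _ => hy' q)
  let bas := Module.Basis.mk hli hsp
  have hbas : ∀ q, bas q = u q := fun q => Module.Basis.mk_apply ..
  -- Only the `q` centralized by `X` contribute diagonal entries. On them `μ X` is a linear
  -- character, so the trace is `|S|` or zero.
  let S : Subgroup Q :=
    { carrier := {q | X * q * X⁻¹ = q}
      one_mem' := by simp
      mul_mem' := by
        intro a b ha hb
        rw [Set.mem_ofPred_eq] at *
        push_cast
        conv_rhs => rw [← ha, ← hb]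
        group
      inv_mem' := by
        intro a ha
        rw [Set.mem_ofPred_eq] at *
        push_cast
        conv_rhs => rw [← ha]
        group }
  have hS : ∀ q : Q, q ∈ S ↔ X * q * X⁻¹ = q := fun q => Iff.rfl
  let shom : S →* ℂ := (Units.coeHom ℂ).comp
    (MonoidHom.mk' (fun q : S => Units.mk0 (μ X (q : Q)) (hμ0 _ _)) (fun r s => by
      ext; exact mulr _ _ _ r.2 s.2))
  have htr : LinearMap.trace ℂ B X.toLinearMap = ∑ q : S, shom q := by
    rw [LinearMap.trace_eq_matrix_trace ℂ bas, Matrix.trace]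
    simp only [Matrix.diag_apply, LinearMap.toMatrix_apply, AlgEquiv.toLinearMap_apply, hbas]
    have : ∀ q : Q, bas.repr (X (u q)) q = if q ∈ S then μ X q else 0 := by
      intro q
      rw [hμ, map_smul, show (u (X * q * X⁻¹) : B) = bas ⟨X * q * X⁻¹, hX q q.2⟩ from
        (hbas ⟨_, _⟩).symm, Module.Basis.repr_self, Finsupp.smul_apply, Finsupp.single_apply]
      simp only [hS, Subtype.ext_iff]
      split_ifs <;> simp
    simp only [this]
    rw [← Finset.sum_filter]
    exact Finset.sum_subtype (p := fun q => q ∈ S) (F := inferInstance) _ (fun q => by simp)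
      (fun q : Q => μ X q)
  rw [htr, sum_hom_units]
  split_ifs with h
  · refine Or.inr ⟨Fintype.card S, Fintype.card_pos, ?_, rfl⟩
    rw [Module.finrank_eq_card_basis bas, ← Nat.card_eq_fintype_card, ← Nat.card_eq_fintype_card]
    exact Subgroup.card_subgroup_dvd_card S
  · left; simp
end

/-! ### Degrees of irreducible projective representations -/

theorem Matrix.isIntegral_trace_of_pow_eq_one {f N : ℕ} (hN : 0 < N)
    (M : Matrix (Fin f) (Fin f) ℂ) (h : M ^ N = 1) : IsIntegral ℤ M.trace := by
  rw [Matrix.trace_eq_sum_roots_charpoly]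
  refine IsIntegral.multiset_sum fun z hz => ?_
  rw [Polynomial.mem_roots M.charpoly_monic.ne_zero, ← Matrix.mem_spectrum_iff_isRoot_charpoly]
    at hz
  have h1 := spectrum.pow_mem_pow M N hz
  rw [h] at h1
  rcases subsingleton_or_nontrivial (Matrix (Fin f) (Fin f) ℂ) with hs | hs
  · rw [spectrum.of_subsingleton] at h1
    exact h1.elim
  · rw [spectrum.one_eq, Set.mem_singleton_iff] at h1
    exact IsIntegral.of_pow hN (h1 ▸ isIntegral_one)

/-- The degree of an irreducible projective representation divides the order of the group. -/
theorem dvd_card_of_projective {Q : Type*} [Group Q] [Fintype Q] {f : ℕ} (hf : 0 < f)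
    (U : Q → Matrix (Fin f) (Fin f) ℂ) (hdet : ∀ q, (U q).det = 1)
    (hmul : ∀ q r, ∃ c : ℂ, U q * U r = c • U (q * r))
    (hfix : ∀ X, (∀ q, U q * X = X * U q) → ∃ c : ℂ, X = c • 1) : f ∣ Fintype.card Q := by
  classical
  choose c hc using hmul
  have hfC : (f : ℂ) ≠ 0 := Nat.cast_ne_zero.2 hf.ne'
  -- Determinant one makes the cocycle values roots of unity; hence each `U q` has finite order and
  -- its inverse has integral trace.
  have hcf : ∀ q r, c q r ^ f = 1 := by
    intro q r
    have := congrArg Matrix.det (hc q r)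
    simpa [hdet] using this.symm
  have hc0 : ∀ q r, c q r ≠ 0 := by
    intro q r h
    have := hcf q r
    rw [h, zero_pow hf.ne'] at this
    exact zero_ne_one this
  have hinv : ∀ q, (U q)⁻¹ * U q = 1 := fun q => Matrix.nonsing_inv_mul _ (by simp [hdet])
  have hinv' : ∀ q, U q * (U q)⁻¹ = 1 := fun q => Matrix.mul_nonsing_inv _ (by simp [hdet])
  have hU1 : (1 : Matrix (Fin f) (Fin f) ℂ) = (c 1 1)⁻¹ • U 1 := by
    have h1 : U 1 = c 1 1 • 1 := by
      have h := congrArg (fun M => M * (U 1)⁻¹) (hc 1 1)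
      simpa [mul_assoc, hinv'] using h
    rw [h1, inv_smul_smul₀ (hc0 _ _)]
  have hpow : ∀ q (n : ℕ), ∃ d : ℂ, d ^ f = 1 ∧ U q ^ n = d • U (q ^ n) := by
    intro q n
    induction n with
    | zero =>
      refine ⟨(c 1 1)⁻¹, by rw [inv_pow, hcf, inv_one], ?_⟩
      rw [pow_zero, pow_zero, ← hU1]
    | succ n ih =>
      obtain ⟨d, hd, h⟩ := ih
      refine ⟨d * c (q ^ n) q, by rw [mul_pow, hd, hcf, one_mul], ?_⟩
      rw [pow_succ, h, smul_mul_assoc, hc, smul_smul, pow_succ]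
  have hord : ∀ q, U q ^ (Fintype.card Q * f) = 1 := by
    intro q
    obtain ⟨d, hd, h⟩ := hpow q (Fintype.card Q)
    have h1 : U 1 = c 1 1 • 1 := by rw [hU1, smul_inv_smul₀ (hc0 _ _)]
    rw [pow_mul, h, pow_card_eq_one, h1, smul_smul, smul_pow, mul_pow, hd, hcf]
    simp
  have hN : 0 < Fintype.card Q * f := Nat.mul_pos Fintype.card_pos hf
  have htr : ∀ q, IsIntegral ℤ ((U q)⁻¹).trace := by
    intro q
    refine Matrix.isIntegral_trace_of_pow_eq_one hN _ ?_
    rw [Matrix.inv_pow', hord, inv_one]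

  have schur : ∀ X : Matrix (Fin f) (Fin f) ℂ,
      ∑ q, U q * X * (U q)⁻¹ = ((Fintype.card Q : ℂ) / f * X.trace) • 1 := by
    intro X
    obtain ⟨s, hs⟩ := hfix (∑ q, U q * X * (U q)⁻¹) (fun r => by
      rw [Finset.mul_sum, Finset.sum_mul, ← Equiv.sum_comp (Equiv.mulLeft r)
        (fun q => U q * X * (U q)⁻¹ * U r)]
      refine Finset.sum_congr rfl fun q _ => ?_
      have h1 : U (r * q) = (c r q)⁻¹ • (U r * U q) := by
        rw [hc, inv_smul_smul₀ (hc0 _ _)]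
      have h2 : (U (r * q))⁻¹ * U r = c r q • (U q)⁻¹ := by
        have h3 : U r = c r q • (U (r * q) * (U q)⁻¹) := by
          rw [← smul_mul_assoc, ← hc, mul_assoc, hinv', mul_one]
        conv_lhs => rw [h3]
        rw [mul_smul_comm, ← mul_assoc, hinv, one_mul]
      rw [Equiv.coe_mulLeft, mul_assoc _ _ (U r), h2, h1]
      simp only [smul_mul_assoc, mul_smul_comm, smul_smul, mul_inv_cancel₀ (hc0 _ _), one_smul,
        mul_assoc])
    have h1 := congrArg Matrix.trace hs
    have h2 : ∀ q, (U q * X * (U q)⁻¹).trace = X.trace := by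
      intro q
      rw [Matrix.trace_mul_comm, ← mul_assoc, hinv, one_mul]
    simp only [Matrix.trace_sum, h2, Matrix.trace_smul, Matrix.trace_one, Finset.sum_const,
      Finset.card_univ, Fintype.card_fin, nsmul_eq_mul, smul_eq_mul] at h1
    rw [hs]
    congr 1
    field_simp
    exact h1.symm
  have casimir : ∀ Y : Matrix (Fin f) (Fin f) ℂ,
      ∑ i, ∑ j, Matrix.single i j (1 : ℂ) * Y * Matrix.single j i 1 = Y.trace • 1 := by
    intro Y
    simp only [Matrix.single_mul_mul_single, one_mul, mul_one]
    rw [Matrix.trace, Finset.sum_smul, Finset.sum_comm]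
    refine Finset.sum_congr rfl fun j _ => ?_
    rw [← Matrix.sum_single_one, Finset.smul_sum]
    simp
  -- Apply the averaging formula `schur` to all matrix units and recombine them with `casimir`.
  have key : ∑ q, (U q)⁻¹.trace • U q = ((Fintype.card Q : ℂ) / f) • 1 := by
    have h1 : ∀ q, (U q)⁻¹.trace • U q =
        ∑ i, ∑ j, (U q * Matrix.single i j (1 : ℂ) * (U q)⁻¹) * Matrix.single j i 1 := by
      intro q
      rw [← mul_one (U q), ← mul_smul_comm, mul_one, ← casimir, Finset.mul_sum]
      refine Finset.sum_congr rfl fun i _ => ?_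
      rw [Finset.mul_sum]
      simp only [mul_assoc]
    simp only [h1]
    rw [Finset.sum_comm]
    have h2 : ∀ i j, ∑ q, (U q * Matrix.single i j (1 : ℂ) * (U q)⁻¹) * Matrix.single j i 1 =
        if i = j then ((Fintype.card Q : ℂ) / f) • Matrix.single i i 1 else 0 := by
      intro i j
      rw [← Finset.sum_mul, schur]
      split_ifs with h
      · subst h
        simp
      · simp [h]
    have h3 : ∀ i, ∑ q, ∑ j, (U q * Matrix.single i j (1 : ℂ) * (U q)⁻¹) * Matrix.single j i 1 =
        ((Fintype.card Q : ℂ) / f) • Matrix.single i i 1 := by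
      intro i
      rw [Finset.sum_comm]
      simp [h2]
    simp only [h3]
    rw [← Finset.smul_sum, Matrix.sum_single_one]

  let R := integralClosure ℤ ℂ
  have hcint : ∀ z : ℂ, z ^ f = 1 → IsIntegral ℤ z := fun z hz =>
    IsIntegral.of_pow hf (hz ▸ isIntegral_one)
  have hsm : ∀ (z : ℂ) (hz : IsIntegral ℤ z) (M : Matrix (Fin f) (Fin f) ℂ),
      z • M = (⟨z, hz⟩ : R) • M := fun _ _ _ => rfl
  -- Over the algebraic integers the `U q` span a finitely generated ring. By `key` it contains the
  -- scalar `|Q|/f`, which is therefore an integer.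
  let S := Submodule.span R (Set.range U)
  have hU : ∀ q, U q ∈ S := fun q => Submodule.subset_span ⟨q, rfl⟩
  have hS1 : (1 : Matrix (Fin f) (Fin f) ℂ) ∈ S := by
    rw [hU1, hsm _ (hcint _ (by rw [inv_pow, hcf, inv_one]))]
    exact S.smul_mem _ (hU 1)
  have hSmul : ∀ x y, x ∈ S → y ∈ S → x * y ∈ S := by
    intro x y hx hy
    have : S * S ≤ S := by
      rw [Submodule.span_mul_span, Submodule.span_le]
      rintro _ ⟨_, ⟨q, rfl⟩, _, ⟨r, rfl⟩, rfl⟩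
      change U q * U r ∈ S
      rw [hc, hsm _ (hcint _ (hcf q r))]
      exact S.smul_mem _ (hU _)
    exact this (Submodule.mul_mem_mul hx hy)
  have hmem : ((Fintype.card Q : ℂ) / f) • (1 : Matrix (Fin f) (Fin f) ℂ) ∈ S := by
    rw [← key]
    refine S.sum_mem fun q _ => ?_
    rw [hsm _ (htr q)]
    exact S.smul_mem _ (hU q)
  have hint : IsIntegral R (((Fintype.card Q : ℂ) / f) • (1 : Matrix (Fin f) (Fin f) ℂ)) := by
    refine IsIntegral.of_mem_of_fg (S.toSubalgebra hS1 hSmul) ?_ _ hmem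
    rw [Submodule.toSubalgebra_toSubmodule]
    exact Submodule.fg_span (Set.finite_range U)
  have : Nonempty (Fin f) := ⟨⟨0, hf⟩⟩
  rw [← Algebra.algebraMap_eq_smul_one, isIntegral_algebraMap_iff
    (FaithfulSMul.algebraMap_injective ℂ (Matrix (Fin f) (Fin f) ℂ))] at hint
  have hintZ : IsIntegral ℤ ((Fintype.card Q : ℂ) / f) := isIntegral_trans _ hint
  have h5 : ((Fintype.card Q : ℂ) / f) = algebraMap ℚ ℂ ((Fintype.card Q : ℚ) / f) := by simp
  rw [h5, isIntegral_algebraMap_iff (algebraMap ℚ ℂ).injective,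
    IsIntegrallyClosed.isIntegral_iff] at hintZ
  obtain ⟨z, hz⟩ := hintZ
  have hfQ : (f : ℚ) ≠ 0 := Nat.cast_ne_zero.2 hf.ne'
  rw [eq_div_iff hfQ] at hz
  have : (f : ℤ) ∣ (Fintype.card Q : ℤ) := ⟨z, by
    have : ((Fintype.card Q : ℤ) : ℚ) = ((f * z : ℤ) : ℚ) := by
      push_cast
      rw [← hz]
      simp [mul_comm]
    exact_mod_cast this⟩
  exact_mod_cast this

/-! ### Minimal normal subgroups modulo a kernel, and `p`-solvability -/

section
variable {G : Type*} [Group G]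

/-- Take the first term `H (i + 1)` of the series whose intersection with `M` escapes `K`.
Minimality puts `M` inside it, while `H i ⊓ M ≤ K`, so the index of `K` in `M` divides that of `H i`
in `H (i + 1)`. -/
theorem IsPSolvable.relIndex_of_minimal {p : ℕ} (h : IsPSolvable p G) (K M : Subgroup G)
    [M.Normal] (hMK : ¬ M ≤ K)
    (hmin : ∀ N : Subgroup G, N.Normal → N ≤ M → ¬ N ≤ K → N = M) :
    (∃ k, K.relIndex M ∣ p ^ k) ∨ ¬ p ∣ K.relIndex M := by
  classical
  obtain ⟨n, H, h0, hn, hnor, hH⟩ := h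
  have hex : ∃ i, ¬ H i ⊓ M ≤ K := ⟨n, by rwa [hn, top_inf_eq]⟩
  obtain ⟨i, hi⟩ : ∃ i, Nat.find hex = i + 1 := by
    refine Nat.exists_eq_succ_of_ne_zero fun h => ?_
    have := Nat.find_spec hex
    rw [h, h0, bot_inf_eq] at this
    exact this bot_le
  have hin : i < n := by
    have := Nat.find_min' hex (show ¬ H n ⊓ M ≤ K by rwa [hn, top_inf_eq])
    omega
  have h1 : ¬ H (i + 1) ⊓ M ≤ K := hi ▸ Nat.find_spec hex
  have h2 : H i ⊓ M ≤ K := not_not.1 (Nat.find_min hex (by omega : i < Nat.find hex))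
  have := hnor (i + 1) hin
  have := hnor i hin.le
  have h3 : M ≤ H (i + 1) := inf_eq_right.1 (hmin _ inferInstance inf_le_right h1)
  have hdvd : K.relIndex M ∣ (H i).relIndex (H (i + 1)) := by
    calc K.relIndex M ∣ (H i ⊓ M).relIndex M := Subgroup.relIndex_dvd_of_le_left M h2
      _ = (H i).relIndex M := Subgroup.inf_relIndex_right ..
      _ = ((H i).subgroupOf (H (i + 1))).relIndex (M.subgroupOf (H (i + 1))) :=
        (Subgroup.relIndex_subgroupOf h3).symm
      _ ∣ (H i).relIndex (H (i + 1)) := Subgroup.relIndex_dvd_index_of_normal ..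
  rcases (hH i hin).2 with ⟨k, hk⟩ | hk
  · exact Or.inl ⟨k, hk ▸ hdvd⟩
  · exact Or.inr fun h => hk (h.trans hdvd)

/-- Otherwise minimality gives `⁅M, M⁆ = M`, and the nontrivial `p`-group `M/(M ∩ K)` would be
perfect. -/
theorem commutator_le_of_minimal [Finite G] {p k : ℕ} (hp : p.Prime) (K M : Subgroup G)
    [K.Normal] [M.Normal] (hMK : ¬ M ≤ K) (hk : K.relIndex M ∣ p ^ k)
    (hmin : ∀ N : Subgroup G, N.Normal → N ≤ M → ¬ N ≤ K → N = M) : ⁅M, M⁆ ≤ K := by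
  by_contra hcon
  have hM : ⁅M, M⁆ = M := hmin _ inferInstance (Subgroup.commutator_le_right M M) hcon
  have : Fact p.Prime := ⟨hp⟩
  have hpg : IsPGroup p (M ⧸ K.subgroupOf M) := by
    obtain ⟨j, -, hj⟩ := (Nat.dvd_prime_pow hp).1 hk
    exact IsPGroup.of_card (n := j) hj
  have := hpg.isNilpotent
  have hnt : Nontrivial (M ⧸ K.subgroupOf M) := by
    rw [QuotientGroup.nontrivial_iff, Ne, Subgroup.subgroupOf_eq_top]
    exact hMK
  have hlt := Group.IsSolvable.commutator_lt_top_of_nontrivial (M ⧸ K.subgroupOf M)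
  apply hlt.ne
  have htop : commutator M = ⊤ := by
    apply Subgroup.map_injective M.subtype_injective
    rw [Subgroup.map_subtype_commutator, hM, ← MonoidHom.range_eq_map, Subgroup.range_subtype]
  have hs := QuotientGroup.mk'_surjective (K.subgroupOf M)
  have h1 := congrArg (Subgroup.map (QuotientGroup.mk' (K.subgroupOf M))) htop
  rwa [commutator_def, Subgroup.map_commutator, Subgroup.map_top_of_surjective _ hs,
    ← commutator_def] at h1
end

/-- The implementing units, rescaled to determinant one, form a projective representation of `Q`;
its commutant is the fixed algebra of `Q`. -/
theorem dvd_card_of_fixed_scalar {B : Type*} [Ring B] [Algebra ℂ B] [Nontrivial B] {f : ℕ}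
    (hf : 0 < f) (e : B ≃ₐ[ℂ] Matrix (Fin f) (Fin f) ℂ) (Q : Subgroup (B ≃ₐ[ℂ] B)) [Finite Q]
    {u : (B ≃ₐ[ℂ] B) → Bˣ} (hu : ∀ α b, α b = u α * b * ↑(u α)⁻¹)
    (hfix : ∀ b, (∀ q ∈ Q, q b = b) → ∃ c : ℂ, b = algebraMap ℂ B c) : f ∣ Nat.card Q := by
  have := Fintype.ofFinite Q
  have hdet : ∀ α, (e (u α)).det ≠ 0 := fun α =>
    ((Matrix.isUnit_iff_isUnit_det _).1 ((u α).isUnit.map e)).ne_zero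
  choose z hz using fun α => IsAlgClosed.exists_pow_nat_eq ((e (u α)).det)⁻¹ hf
  have hz0 : ∀ α, z α ≠ 0 := by
    intro α h
    have := hz α
    rw [h, zero_pow hf.ne'] at this
    exact inv_ne_zero (hdet α) this.symm
  rw [Nat.card_eq_fintype_card]
  refine dvd_card_of_projective hf (fun q : Q => z q • e (u q)) ?_ ?_ ?_
  · intro q
    rw [Matrix.det_smul, Fintype.card_fin, hz, inv_mul_cancel₀ (hdet _)]
  · intro q r
    obtain ⟨c, hc0, hc⟩ := exists_smul_mul hu hfix (q : B ≃ₐ[ℂ] B) r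
    refine ⟨z q * z r * (z (q * r) * c)⁻¹, ?_⟩
    have hne := hz0 (q * r)
    rw [Subgroup.coe_mul, hc, map_smul, map_mul, smul_smul, smul_smul, smul_mul_smul_comm]
    congr 1
    field_simp
  · intro X hX
    obtain ⟨c, hc⟩ := hfix (e.symm X) (fun q hq => by
      have h := hX ⟨q, hq⟩
      rw [smul_mul_assoc, mul_smul_comm] at h
      have h' := smul_right_injective _ (hz0 q) h
      have h2 := congrArg e.symm h'
      simp only [map_mul, AlgEquiv.symm_apply_apply] at h2
      rw [hu, h2, mul_assoc, Units.mul_inv, mul_one])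
    refine ⟨c, ?_⟩
    rw [← e.apply_symm_apply X, hc, AlgEquiv.commutes, Algebra.algebraMap_eq_smul_one]

/-! ### Fixed subalgebras of group actions -/

section
variable {G K A : Type*} [Group G] [Field K] [Ring A] [Algebra K A]

/-- The elements of `A` fixed by the subgroup `N`. -/
def fixedSubalgebra (φ : G →* (A ≃ₐ[K] A)) (N : Subgroup G) : Subalgebra K A where
  carrier := {a | ∀ g ∈ N, φ g a = a}
  mul_mem' ha hb g hg := by rw [map_mul, ha g hg, hb g hg]
  add_mem' ha hb g hg := by rw [map_add, ha g hg, hb g hg]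
  algebraMap_mem' r g _ := (φ g).commutes r

theorem mem_fixedSubalgebra {φ : G →* (A ≃ₐ[K] A)} {N : Subgroup G} {a : A} :
    a ∈ fixedSubalgebra φ N ↔ ∀ g ∈ N, φ g a = a := Iff.rfl

theorem mem_fixedSubalgebra_sup {φ : G →* (A ≃ₐ[K] A)} {M N : Subgroup G} {a : A} :
    a ∈ fixedSubalgebra φ (M ⊔ N) ↔ a ∈ fixedSubalgebra φ M ∧ a ∈ fixedSubalgebra φ N := by
  let S : Subgroup G :=
    { carrier := {g | φ g a = a}
      one_mem' := by simp
      mul_mem' := by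
        intro g h (hg : φ g a = a) (hh : φ h a = a)
        change φ (g * h) a = a
        rw [map_mul, AlgEquiv.mul_apply, hh, hg]
      inv_mem' := by
        intro g (hg : φ g a = a)
        change φ g⁻¹ a = a
        conv_lhs => rw [← hg]
        rw [← AlgEquiv.mul_apply, ← map_mul, inv_mul_cancel, map_one, AlgEquiv.one_apply] }
  exact sup_le_iff (c := S)

theorem apply_mem_fixedSubalgebra {φ : G →* (A ≃ₐ[K] A)} {M : Subgroup G} [hM : M.Normal] (g : G)
    {a : A} (ha : a ∈ fixedSubalgebra φ M) : φ g a ∈ fixedSubalgebra φ M := by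
  intro m hm
  rw [← AlgEquiv.mul_apply, ← map_mul, show m * g = g * (g⁻¹ * m * g) by group, map_mul,
    AlgEquiv.mul_apply, ha _ (by simpa using hM.conj_mem m hm g⁻¹)]

/-- The action of `G` on an invariant subalgebra. -/
def restrictAction (φ : G →* (A ≃ₐ[K] A)) (S : Subalgebra K A)
    (hS : ∀ g, ∀ a ∈ S, φ g a ∈ S) : G →* (S ≃ₐ[K] S) where
  toFun g := AlgEquiv.ofAlgHom
    (((φ g).toAlgHom.comp S.val).codRestrict S fun a => hS g a a.2)
    (((φ g⁻¹).toAlgHom.comp S.val).codRestrict S fun a => hS g⁻¹ a a.2)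
    (by
      ext a
      change φ g (φ g⁻¹ a) = a
      rw [← AlgEquiv.mul_apply, ← map_mul, mul_inv_cancel, map_one, AlgEquiv.one_apply])
    (by
      ext a
      change φ g⁻¹ (φ g a) = a
      rw [← AlgEquiv.mul_apply, ← map_mul, inv_mul_cancel, map_one, AlgEquiv.one_apply])
  map_one' := by
    ext a
    change φ 1 (a : A) = a
    rw [map_one, AlgEquiv.one_apply]
  map_mul' g h := by
    ext a
    change φ (g * h) (a : A) = φ g (φ h a)
    rw [map_mul, AlgEquiv.mul_apply]

theorem coe_restrictAction_apply (φ : G →* (A ≃ₐ[K] A)) (S : Subalgebra K A)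
    (hS : ∀ g, ∀ a ∈ S, φ g a ∈ S) (g : G) (a : S) :
    (restrictAction φ S hS g a : A) = φ g a := rfl

/-- The `N`-fixed points of the `M`-fixed algebra are the `M ⊔ N`-fixed points, so simplicity passes
to the smaller algebra in the induction. -/
theorem isSimpleRing_fixedSubalgebra_restrict (φ : G →* (A ≃ₐ[K] A)) (M N : Subgroup G)
    (hS : ∀ g, ∀ a ∈ fixedSubalgebra φ M, φ g a ∈ fixedSubalgebra φ M)
    (h : IsSimpleRing (fixedSubalgebra φ (M ⊔ N))) :
    IsSimpleRing (fixedSubalgebra (restrictAction φ (fixedSubalgebra φ M) hS) N) := by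
  refine IsSimpleRing.of_ringEquiv (R := fixedSubalgebra φ (M ⊔ N)) ?_ h
  exact
    { toFun := fun a => ⟨⟨a, (mem_fixedSubalgebra_sup.1 a.2).1⟩, fun g hg =>
        Subtype.ext ((mem_fixedSubalgebra_sup.1 a.2).2 g hg)⟩
      invFun := fun a => ⟨a, mem_fixedSubalgebra_sup.2 ⟨a.1.2, fun g hg =>
        congrArg Subtype.val (a.2 g hg)⟩⟩
      left_inv := fun _ => rfl
      right_inv := fun _ => rfl
      map_mul' := fun _ _ => rfl
      map_add' := fun _ _ => rfl }

theorem apply_mem_centralizer (φ : G →* (A ≃ₐ[K] A)) (S : Subalgebra K A)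
    (hS : ∀ g, ∀ a ∈ S, φ g a ∈ S) (g : G) (a : A)
    (ha : a ∈ Subalgebra.centralizer K (S : Set A)) :
    φ g a ∈ Subalgebra.centralizer K (S : Set A) := by
  rw [Subalgebra.mem_centralizer_iff] at *
  intro s hs
  have h1 : φ g (φ g⁻¹ s) = s := by
    rw [← AlgEquiv.mul_apply, ← map_mul, mul_inv_cancel, map_one, AlgEquiv.one_apply]
  rw [← h1, ← map_mul, ha _ (hS g⁻¹ s hs), map_mul]

end

/-! ### The induction on dimension -/

/-- The trace of a group element acting on an algebra whose subalgebras of fixed points under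
normal subgroups are all simple. -/
theorem trace_action_eq_zero_or_dvd {G : Type*} [Group G] [Finite G] (n : ℕ) :
    ∀ (A : Type) [Ring A] [Algebra ℂ A] [FiniteDimensional ℂ A] (φ : G →* (A ≃ₐ[ℂ] A)),
      Module.finrank ℂ A = n →
      (∀ N : Subgroup G, N.Normal → IsSimpleRing (fixedSubalgebra φ N)) →
      fixedSubalgebra φ ⊤ = ⊥ →
      (∀ p : ℕ, p.Prime → p ∣ Module.finrank ℂ A → IsPSolvable p G) →
      ∀ x, LinearMap.trace ℂ A (φ x).toLinearMap = 0 ∨ ∃ m : ℕ, 0 < m ∧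
        m ∣ Module.finrank ℂ A ∧ LinearMap.trace ℂ A (φ x).toLinearMap = m := by
  induction n using Nat.strong_induction_on with
  | _ n ih =>
  intro A _ _ _ φ hn hsimple hfix hsol x
  have hA : IsSimpleRing A := by
    have h := hsimple ⊥ inferInstance
    have : fixedSubalgebra φ ⊥ = ⊤ := by
      ext a
      simp [mem_fixedSubalgebra]
    rw [this] at h
    exact IsSimpleRing.of_ringEquiv (Subalgebra.topEquiv (R := ℂ)).toRingEquiv h
  by_cases htriv : φ.ker = ⊤
  · have h1 : ∀ g, φ g = 1 := fun g => by
      rw [← MonoidHom.mem_ker, htriv]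
      trivial
    have h2 : (⊥ : Subalgebra ℂ A) = ⊤ := by
      rw [← hfix]
      ext a
      simp [mem_fixedSubalgebra, h1]
    have h3 : Module.finrank ℂ A = 1 := Subalgebra.bot_eq_top_iff_finrank_eq_one.1 h2
    refine Or.inr ⟨1, one_pos, one_dvd _, ?_⟩
    rw [h1]
    have : (1 : A ≃ₐ[ℂ] A).toLinearMap = LinearMap.id := rfl
    rw [this, LinearMap.trace_id, h3]
  obtain ⟨M, ⟨hMn, hMK⟩, hMmin⟩ := Set.Finite.exists_minimal
    (s := {N : Subgroup G | N.Normal ∧ ¬ N ≤ φ.ker}) (Set.toFinite _)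
    ⟨⊤, inferInstance, fun h => htriv (top_le_iff.1 h)⟩
  have hmin : ∀ N : Subgroup G, N.Normal → N ≤ M → ¬ N ≤ φ.ker → N = M :=
    fun N hN hNM hNK => le_antisymm hNM (hMmin ⟨hN, hNK⟩ hNM)
  obtain ⟨C, hCdef⟩ : ∃ C, C = fixedSubalgebra φ M := ⟨_, rfl⟩
  have hCtop : C ≠ ⊤ := by
    intro h
    apply hMK
    intro m hm
    rw [MonoidHom.mem_ker]
    ext a
    have : a ∈ C := h ▸ Algebra.mem_top
    rw [hCdef] at this
    exact this m hm
  have hCst : ∀ g, ∀ a ∈ C, φ g a ∈ C := by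
    subst hCdef
    exact fun g a => apply_mem_fixedSubalgebra g
  have hCsimple : IsSimpleRing C := hCdef ▸ hsimple M hMn
  obtain ⟨k, hk, ⟨e⟩⟩ := IsSimpleRing.exists_algEquiv_matrix_of_isAlgClosed ℂ C
  have hBst := apply_mem_centralizer φ C hCst
  have hBsimple : IsSimpleRing (Subalgebra.centralizer ℂ (C : Set A)) := by
    obtain ⟨ψ, hψ, -⟩ := exists_matrixHom_range_eq C e
    rw [← hψ]
    exact isSimpleRing_centralizer_matrix ψ
  have hfin := finrank_eq_mul_of_centralizer C e
  have htr := trace_eq_mul_of_centralizer C e (φ x).toLinearMap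
    (restrictAction φ C hCst x).toLinearMap
    (restrictAction φ _ hBst x).toLinearMap (fun b c => map_mul (φ x) _ _)
  have hCA : Module.finrank ℂ C < Module.finrank ℂ A := by
    refine lt_of_le_of_ne (Submodule.finrank_le (Subalgebra.toSubmodule C)) fun h => hCtop ?_
    exact Algebra.toSubmodule_eq_top.1 (Submodule.eq_top_of_finrank_eq h)
  have ihC := ih _ (hn ▸ hCA) C (restrictAction φ C hCst) rfl
    (by
      subst hCdef
      exact fun N hN => isSimpleRing_fixedSubalgebra_restrict φ M N _
        (hsimple _ (Subgroup.sup_normal M N)))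
    (by
      rw [eq_bot_iff]
      intro c hc
      have : (c : A) ∈ fixedSubalgebra φ ⊤ := fun g hg => congrArg Subtype.val (hc g hg)
      rw [hfix, Algebra.mem_bot] at this
      obtain ⟨r, hr⟩ := this
      exact Algebra.mem_bot.2 ⟨r, Subtype.ext hr⟩)
    (fun p hp hpd => hsol p hp (hpd.trans (hfin ▸ dvd_mul_left _ _))) x
  obtain ⟨f, hf, ⟨eB⟩⟩ := IsSimpleRing.exists_algEquiv_matrix_of_isAlgClosed ℂ
    (Subalgebra.centralizer ℂ (C : Set A))
  obtain ⟨φB, hφB⟩ : ∃ φB, φB = restrictAction φ _ hBst := ⟨_, rfl⟩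
  rw [← hφB] at htr
  choose u hu using AlgEquiv.exists_unit_conj eB
  have hcenter : ∀ c : C, (∀ d : C, c * d = d * c) → ∃ r : ℂ, c = algebraMap ℂ C r := by
    intro c hc
    have : e c ∈ Subalgebra.center ℂ (Matrix (Fin k) (Fin k) ℂ) := by
      rw [Subalgebra.mem_center_iff]
      intro y
      rw [← e.apply_symm_apply y, ← map_mul, ← map_mul, hc]
    rw [Algebra.IsCentral.mem_center_iff] at this
    obtain ⟨r, hr⟩ := this
    refine ⟨r, e.injective ?_⟩
    rw [hr, AlgEquiv.commutes]
  have hCmem : ∀ a : A, (∀ m ∈ M, φ m a = a) → a ∈ C := by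
    rw [hCdef]
    exact fun a h => h
  have hQfin : Finite (M.map φB) := ((Set.toFinite (M : Set G)).image φB).to_subtype
  have hfixB : ∀ b, (∀ q ∈ M.map φB, q b = b) → ∃ c : ℂ, b = algebraMap ℂ _ c := by
    intro b hb
    have hbC : (b : A) ∈ C := hCmem b fun m hm => by
      have := hb (φB m) ⟨m, hm, rfl⟩
      rw [hφB] at this
      exact congrArg Subtype.val this
    obtain ⟨r, hr⟩ := hcenter ⟨b, hbC⟩ (fun d => Subtype.ext
      ((Subalgebra.mem_centralizer_iff ℂ).1 b.2 d d.2).symm)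
    exact ⟨r, Subtype.ext (congrArg (fun c : C => (c : A)) hr)⟩
  by_cases hcomm : ⁅M, M⁆ ≤ φ.ker
  · have hB := trace_eq_zero_or_dvd_of_commutative (M.map φB) (by
        rintro _ ⟨a, ha, rfl⟩ _ ⟨b, hb, rfl⟩
        have h1 : φ (a * b) = φ (b * a) := by
          have h2 := hcomm (Subgroup.commutator_mem_commutator ha hb)
          rw [MonoidHom.mem_ker, commutatorElement_def] at h2
          rw [show a * b = (a * b * a⁻¹ * b⁻¹) * (b * a) by group, map_mul, h2, one_mul]
        rw [← map_mul, ← map_mul, hφB]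
        ext y
        rw [coe_restrictAction_apply, coe_restrictAction_apply, h1]) hu hfixB (φB x) (by
        rintro _ ⟨a, ha, rfl⟩
        exact ⟨x * a * x⁻¹, hMn.conj_mem a ha x, by simp⟩)
    rw [htr]
    rcases hB with h | ⟨m, hm, hmd, h⟩
    · left; rw [h, zero_mul]
    rcases ihC with h' | ⟨m', hm', hmd', h'⟩
    · left; rw [h', mul_zero]
    right
    exact ⟨m * m', Nat.mul_pos hm hm', hfin ▸ mul_dvd_mul hmd hmd', by rw [h, h']; push_cast; rfl⟩
  -- A prime dividing `f` would divide `dim A = f² dim C`, hence not the index of the kernel in `M`;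
  -- yet `f` divides `|Q|`, which divides that index.
  · exfalso
    have hcop : ∀ p : ℕ, p.Prime → p ∣ Module.finrank ℂ A → ¬ p ∣ φ.ker.relIndex M := by
      intro p hp hpd
      refine ((hsol p hp hpd).relIndex_of_minimal φ.ker M hMK hmin).resolve_left ?_
      rintro ⟨j, hj⟩
      exact hcomm (commutator_le_of_minimal hp φ.ker M hMK hj hmin)
    have hfcard := dvd_card_of_fixed_scalar (NeZero.pos f) eB (M.map φB) hu hfixB
    have hdvd : Nat.card (M.map φB) ∣ φ.ker.relIndex M := by
      rw [← Subgroup.relIndex_ker]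
      refine Subgroup.relIndex_dvd_of_le_left M fun g hg => ?_
      rw [MonoidHom.mem_ker] at *
      rw [hφB]
      ext y
      rw [coe_restrictAction_apply, hg]
      rfl
    have hfB : Module.finrank ℂ (Subalgebra.centralizer ℂ (C : Set A)) = f * f := by
      rw [eB.toLinearEquiv.finrank_eq, Module.finrank_matrix]
      simp
    have hf1 : f = 1 := by
      by_contra hne
      obtain ⟨p, hp, hpf⟩ := Nat.exists_prime_and_dvd hne
      refine hcop p hp ?_ (hpf.trans (hfcard.trans hdvd))
      rw [hfin, hfB, mul_assoc]
      exact hpf.mul_right _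
    rw [hfin, hfB, hf1] at hCA
    simp at hCA

/-! ### From characters to the conjugation action -/

/-- Burnside's theorem: by Schur the module endomorphisms are scalars, so every linear map commutes
with them and Jacobson density applies on a finite spanning set. -/
theorem Representation.asAlgebraHom_surjective {G V : Type*} [Group G] [AddCommGroup V]
    [Module ℂ V] [FiniteDimensional ℂ V] (σ : Representation ℂ G V) (hσ : σ.IsIrreducible) :
    Function.Surjective σ.asAlgebraHom := by
  have hsimple := (Representation.irreducible_iff_isSimpleModule_asModule σ).1 hσ
  intro f
  let f' : Module.End (Module.End (MonoidAlgebra ℂ G) σ.asModule) σ.asModule :=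
    { toFun := fun m => σ.asModuleEquiv.symm (f (σ.asModuleEquiv m))
      map_add' := by simp
      map_smul' := by
        intro d m
        obtain ⟨c, rfl⟩ := (IsSimpleModule.algebraMap_end_bijective_of_isAlgClosed
          (A := MonoidAlgebra ℂ G) (V := σ.asModule) ℂ).2 d
        change σ.asModuleEquiv.symm (f (σ.asModuleEquiv (c • m))) =
          c • σ.asModuleEquiv.symm (f (σ.asModuleEquiv m))
        simp only [map_smul] }
  obtain ⟨s, hs⟩ := Module.Finite.fg_top (R := ℂ) (M := V)
  obtain ⟨r, hr⟩ := jacobson_density f' (s.map σ.asModuleEquiv.symm.toEquiv.toEmbedding)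
  refine ⟨r, LinearMap.ext_on hs fun v hv => ?_⟩
  have := hr (σ.asModuleEquiv.symm v) (by simpa using hv)
  have h2 := congrArg σ.asModuleEquiv this
  rw [Representation.asModuleEquiv_map_smul] at h2
  simpa [f'] using h2.symm

theorem Representation.trace_asAlgebraHom_eq {G V W : Type*} [Group G] [AddCommGroup V]
    [Module ℂ V] [AddCommGroup W] [Module ℂ W] (ρ : Representation ℂ G W)
    (σ : Representation ℂ G V) (e : ℂ) (h : ∀ g, ρ.character g = e * σ.character g)
    (a : MonoidAlgebra ℂ G) :
    LinearMap.trace ℂ W (ρ.asAlgebraHom a) = e * LinearMap.trace ℂ V (σ.asAlgebraHom a) := by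
  induction a using MonoidAlgebra.induction_linear with
  | zero => simp
  | add x y hx hy => simp only [map_add, hx, hy, mul_add]
  | single g r =>
    rw [asAlgebraHom_single, asAlgebraHom_single, map_smul, map_smul, smul_eq_mul, smul_eq_mul]
    have := h g
    rw [character, character] at this
    rw [this]
    ring

/-- If the character of `ρ` is a multiple of an irreducible character, then the commutant of `ρ` is
a simple algebra. -/
theorem Representation.isSimpleRing_centralizer {G W : Type*} [Group G] [Finite G]
    [AddCommGroup W] [Module ℂ W] [FiniteDimensional ℂ W] [Nontrivial W]
    (ρ : Representation ℂ G W) {f : ℕ}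
    (σ : Representation ℂ G (Fin f → ℂ)) (hσ : σ.IsIrreducible) (e : ℂ)
    (h : ∀ g, ρ.character g = e * σ.character g) :
    IsSimpleRing (Subalgebra.centralizer ℂ (Set.range ρ)) := by
  have hs := σ.asAlgebraHom_surjective hσ
  -- By semisimplicity the kernel of `σ` is generated by an idempotent. Its image under `ρ` is an
  -- idempotent of trace zero, hence zero, so `ρ` factors through the matrix algebra `End(ℂ^f)`.
  have hker : ∀ a, a ∈ RingHom.ker σ.asAlgebraHom → ρ.asAlgebraHom a = 0 := by
    obtain ⟨i, hi, hI⟩ := IsSemisimpleRing.ideal_eq_span_idempotent (RingHom.ker σ.asAlgebraHom)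
    have hσi : σ.asAlgebraHom i = 0 := by
      have : i ∈ RingHom.ker σ.asAlgebraHom := hI ▸ Ideal.mem_span_singleton_self i
      exact this
    have hρi : ρ.asAlgebraHom i = 0 := by
      refine LinearMap.IsIdempotentElem.eq_zero_of_trace_eq_zero (hi.map ρ.asAlgebraHom) ?_
      rw [ρ.trace_asAlgebraHom_eq σ e h, hσi, map_zero, mul_zero]
    intro a ha
    rw [hI, Ideal.mem_span_singleton'] at ha
    obtain ⟨b, rfl⟩ := ha
    rw [map_mul, hρi, mul_zero]
  have hEnd : IsSimpleRing (Module.End ℂ W) := by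
    have : Nonempty (Fin (Module.finrank ℂ W)) := ⟨⟨0, Module.finrank_pos⟩⟩
    exact IsSimpleRing.of_ringEquiv (algEquivMatrix (Module.finBasis ℂ W)).symm.toRingEquiv
      inferInstance
  let q : (MonoidAlgebra ℂ G ⧸ RingHom.ker σ.asAlgebraHom) ≃ₐ[ℂ] Module.End ℂ (Fin f → ℂ) :=
    Ideal.quotientKerAlgEquivOfSurjective hs
  let l : (MonoidAlgebra ℂ G ⧸ RingHom.ker σ.asAlgebraHom) →ₐ[ℂ] Module.End ℂ W :=
    Ideal.Quotient.liftₐ (RingHom.ker σ.asAlgebraHom) ρ.asAlgebraHom hker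
  let ψ : Module.End ℂ (Fin f → ℂ) →ₐ[ℂ] Module.End ℂ W := l.comp q.symm.toAlgHom
  have hψ : ∀ a, ψ (σ.asAlgebraHom a) = ρ.asAlgebraHom a := by
    intro a
    have : q.symm (σ.asAlgebraHom a) = Ideal.Quotient.mk _ a := by
      rw [AlgEquiv.symm_apply_eq]
      rfl
    change l (q.symm _) = _
    rw [this]
    rfl
  have hcent : Subalgebra.centralizer ℂ (Set.range ρ) = Subalgebra.centralizer ℂ
      ((ψ.comp (Matrix.toLinAlgEquiv' (R := ℂ) (n := Fin f)).toAlgHom).range :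
        Set (Module.End ℂ W)) := by
    ext z
    rw [Subalgebra.mem_centralizer_iff, Subalgebra.mem_centralizer_iff]
    constructor
    · rintro hz _ ⟨c, rfl⟩
      obtain ⟨a, ha⟩ := hs (Matrix.toLinAlgEquiv' c)
      change ψ (Matrix.toLinAlgEquiv' c) * z = z * ψ (Matrix.toLinAlgEquiv' c)
      rw [← ha, hψ]
      clear ha
      induction a using MonoidAlgebra.induction_linear with
      | zero => simp
      | add x y hx hy => rw [map_add, add_mul, mul_add, hx, hy]
      | single g r =>
        rw [asAlgebraHom_single, smul_mul_assoc, mul_smul_comm, hz _ ⟨g, rfl⟩]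
    · rintro hz _ ⟨g, rfl⟩
      refine hz _ ⟨Matrix.toLinAlgEquiv'.symm (σ g), ?_⟩
      change ψ (Matrix.toLinAlgEquiv' (Matrix.toLinAlgEquiv'.symm (σ g))) = ρ g
      rw [AlgEquiv.apply_symm_apply, ← σ.asAlgebraHom_single_one, hψ, ρ.asAlgebraHom_single_one]
  rw [hcent]
  exact isSimpleRing_centralizer_matrix _

/-- The conjugation action of a group on the endomorphism algebra of a representation. -/
noncomputable def Representation.conjAction {G W : Type*} [Group G] [AddCommGroup W] [Module ℂ W]
    (ρ : Representation ℂ G W) : G →* (Module.End ℂ W ≃ₐ[ℂ] Module.End ℂ W) :=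
  (MulSemiringAction.toAlgAut (ConjAct (Module.End ℂ W)ˣ) ℂ (Module.End ℂ W)).comp
    (ConjAct.toConjAct.toMonoidHom.comp (MonoidHom.toHomUnits ρ))

theorem Representation.conjAction_apply {G W : Type*} [Group G] [AddCommGroup W] [Module ℂ W]
    (ρ : Representation ℂ G W) (g : G) (a : Module.End ℂ W) :
    ρ.conjAction g a = ρ g * a * ρ g⁻¹ := by
  change ConjAct.toConjAct (MonoidHom.toHomUnits ρ g) • a = _
  rw [ConjAct.units_smul_def, ConjAct.ofConjAct_toConjAct, ← map_inv]
  rfl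

theorem Representation.conjAction_apply_eq_iff {G W : Type*} [Group G] [AddCommGroup W]
    [Module ℂ W] (ρ : Representation ℂ G W) (g : G) (a : Module.End ℂ W) :
    ρ.conjAction g a = a ↔ ρ g * a = a * ρ g := by
  rw [conjAction_apply]
  have h1 : ρ g⁻¹ * ρ g = 1 := by rw [← map_mul, inv_mul_cancel, map_one]
  have h2 : ρ g * ρ g⁻¹ = 1 := by rw [← map_mul, mul_inv_cancel, map_one]
  constructor
  · intro h
    conv_rhs => rw [← h]
    rw [mul_assoc, h1, mul_one]
  · intro h
    rw [h, mul_assoc, h2, mul_one]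

theorem Representation.trace_conjAction {G W : Type*} [Group G] [AddCommGroup W] [Module ℂ W]
    [FiniteDimensional ℂ W] (ρ : Representation ℂ G W) (g : G) :
    LinearMap.trace ℂ _ (ρ.conjAction g).toLinearMap = ρ.character g⁻¹ * ρ.character g := by
  rw [← char_linHom]
  congr 1

theorem Representation.fixedSubalgebra_conjAction {G W : Type*} [Group G] [AddCommGroup W]
    [Module ℂ W] (ρ : Representation ℂ G W) (N : Subgroup G) :
    fixedSubalgebra ρ.conjAction N =
      Subalgebra.centralizer ℂ (Set.range (ρ.comp N.subtype : Representation ℂ N W)) := by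
  ext a
  rw [mem_fixedSubalgebra, Subalgebra.mem_centralizer_iff]
  simp only [conjAction_apply_eq_iff]
  exact ⟨by rintro h _ ⟨g, rfl⟩; exact h g g.2, fun h g hg => h _ ⟨⟨g, hg⟩, rfl⟩⟩

open scoped ComplexOrder in
theorem Representation.character_inv_eq_conj {G : Type*} [Group G] [Finite G] {n : ℕ}
    (ρ : Representation ℂ G (Fin n → ℂ)) (g : G) :
    ρ.character g⁻¹ = (starRingEnd ℂ) (ρ.character g) := by
  classical
  have := Fintype.ofFinite G
  let M : G →* Matrix (Fin n) (Fin n) ℂ :=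
    (LinearMap.toMatrixAlgEquiv' : _ ≃ₐ[ℂ] Matrix (Fin n) (Fin n) ℂ).toMonoidHom.comp ρ
  have htr : ∀ g, ρ.character g = (M g).trace := fun g =>
    LinearMap.trace_eq_matrix_trace ℂ (Pi.basisFun ℂ (Fin n)) (ρ g)
  -- The averaged invariant Hermitian form; it conjugates `(M g)ᴴ` into `M g⁻¹`.
  let P : Matrix (Fin n) (Fin n) ℂ := ∑ h, (M h).conjTranspose * M h
  have hP : P.PosDef := by
    have : P = (M 1).conjTranspose * M 1 +
        ∑ h ∈ Finset.univ.erase 1, (M h).conjTranspose * M h :=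
      (Finset.add_sum_erase _ _ (Finset.mem_univ 1)).symm
    rw [this]
    refine Matrix.PosDef.add_posSemidef ?_ ?_
    · rw [map_one, Matrix.conjTranspose_one, one_mul]
      exact Matrix.PosDef.one
    · exact Matrix.posSemidef_sum _ fun h _ => Matrix.posSemidef_conjTranspose_mul_self _
  have hPu : IsUnit P.det := (Matrix.isUnit_iff_isUnit_det P).1 hP.isUnit
  have hinv : (M g).conjTranspose * P = P * M g⁻¹ := by
    simp only [P, Finset.mul_sum, Finset.sum_mul]
    rw [← Equiv.sum_comp (Equiv.mulRight g) fun h => (M h).conjTranspose * M h * M g⁻¹]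
    refine Finset.sum_congr rfl fun h _ => ?_
    rw [Equiv.coe_mulRight, map_mul, Matrix.conjTranspose_mul]
    have : M g * M g⁻¹ = 1 := by rw [← map_mul, mul_inv_cancel, map_one]
    simp only [mul_assoc, this, mul_one]
  have h1 : M g⁻¹ = P⁻¹ * ((M g).conjTranspose * P) := by
    rw [hinv, ← mul_assoc, Matrix.nonsing_inv_mul _ hPu, one_mul]
  rw [htr, htr, h1, Matrix.trace_mul_comm, mul_assoc, Matrix.mul_nonsing_inv _ hPu, mul_one,
    Matrix.trace_conjTranspose]
  rfl

theorem Representation.centralizer_range_eq_bot {G W : Type*} [Group G] [AddCommGroup W]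
    [Module ℂ W] [FiniteDimensional ℂ W] (ρ : Representation ℂ G W) (hρ : ρ.IsIrreducible) :
    Subalgebra.centralizer ℂ (Set.range ρ) = ⊥ := by
  rw [eq_bot_iff]
  intro a ha
  rw [Subalgebra.mem_centralizer_iff] at ha
  obtain ⟨c, hc⟩ := (IsIrreducible.algebraMap_intertwiningMap_bijective_of_isAlgClosed
    (ρ := ρ)).2 ⟨a, fun g => (ha _ ⟨g, rfl⟩).symm⟩
  exact Algebra.mem_bot.2 ⟨c, congrArg IntertwiningMap.toLinearMap hc⟩

/-- Here `d` is the degree `χ(1)`, as a natural number. -/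
theorem theoremB {G : Type*} [Group G] [Finite G] (χ : G → ℂ) (hχ : IsQuasiPrimitive χ)
    (d : ℕ) (hd : χ 1 = (d : ℂ))
    (hsol : ∀ p : ℕ, p.Prime → p ∣ d → IsPSolvable p G) (x : G) :
    ‖χ x‖ ^ 2 = 0 ∨ ∃ m : ℕ, 0 < m ∧ m ∣ d ^ 2 ∧ ‖χ x‖ ^ 2 = (m : ℝ) := by
  obtain ⟨⟨n, ρ, hρ, hχρ⟩, hquasi⟩ := hχ
  have hdn : d = n := by
    rw [hχρ, Representation.char_one, Module.finrank_fin_fun] at hd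
    exact_mod_cast hd.symm
  subst hdn
  have hnt : Nontrivial (Fin d → ℂ) := by
    have := (Representation.irreducible_iff_isSimpleModule_asModule ρ).1 hρ
    exact IsSimpleModule.nontrivial (MonoidAlgebra ℂ G) ρ.asModule
  have hfin : Module.finrank ℂ (Module.End ℂ (Fin d → ℂ)) = d ^ 2 := by
    rw [Module.finrank_linearMap, Module.finrank_fin_fun, sq]
  have hnorm : LinearMap.trace ℂ _ (ρ.conjAction x).toLinearMap = ((‖χ x‖ ^ 2 : ℝ) : ℂ) := by
    rw [Representation.trace_conjAction, Representation.character_inv_eq_conj, ← hχρ,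
      ← Complex.normSq_eq_conj_mul_self, Complex.normSq_eq_norm_sq]
  have key := trace_action_eq_zero_or_dvd _ (Module.End ℂ (Fin d → ℂ)) ρ.conjAction rfl
    (by
      intro N hN
      rw [Representation.fixedSubalgebra_conjAction]
      obtain ⟨θ, e, ⟨f, σ, hσ, hθ⟩, hres⟩ := hquasi N hN
      refine Representation.isSimpleRing_centralizer _ σ hσ e fun g => ?_
      rw [← hθ, ← hres, hχρ]
      rfl)
    (by
      rw [← ρ.centralizer_range_eq_bot hρ]
      ext a
      simp only [mem_fixedSubalgebra, Subalgebra.mem_centralizer_iff,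
        Representation.conjAction_apply_eq_iff, Set.forall_mem_range, Subgroup.mem_top,
        forall_true_left])
    (fun p hp hpd => hsol p hp (hp.dvd_of_dvd_pow (hfin ▸ hpd))) x
  rw [hnorm, hfin] at key
  rcases key with h | ⟨m, hm, hmd, h⟩
  · exact Or.inl (by exact_mod_cast h)
  · exact Or.inr ⟨m, hm, hmd, by exact_mod_cast h⟩
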